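/- Let $\mathbb{F}$ be $\mathbb{R}$ or $\mathbb{C}$, let $\langle x,x^*\rangle$ be the free monoid of words in the $2g$ letters $x_1,\dots,x_g,x_1^*,\dots,x_g^*$, and let $\mathbb{F}\langle x,x^*\rangle$ be the free algebra on these letters, with the conjugate-linear involution $*$ that reverses words and exchanges $x_j$ and $x_j^*$. A polynomial is *analytic* if no letter $x_j^*$ occurs in it. A *$*$-ideal* is a left (hence two-sided) ideal $I$ with $I^*=I$. A *monomial order* is a total well-ordering $\prec$ on $\langle x,x^*\rangle$ such that $a\prec b$ implies $ca\prec cb$ and $ac\prec bc$ for all words $a,b,c$. For a nonzero polynomial $p$, let $T(p)$ be the $\prec$-largest word occurring in $p$; $p$ is *monic* if the coefficient of $T(p)$ in $p$ is $1$. A word $a$ *divides* a word $b$ if $b=cad$ for some words $c,d$. A *reduced Gröbner basis* of a two-sided ideal $I$ is a set $B\subseteq I$ such that (1) for each nonzero $f\in I$ there is $b\in B$ such that $T(b)$ divides $T(f)$; (2) each element of $B$ is monic; (3) if $b_1\ne b_2$ are elements of $B$, then $T(b_1)$ does not divide any word occurring in $b_2$. **Proposition 4.1.** Let $\prec$ be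 a monomial order on $\langle x,x^*\rangle$, and let $I\subseteq\mathbb{F}\langle x,x^*\rangle$ be the $*$-ideal generated by a set of nonzero analytic polynomials. Then the reduced Gröbner basis of $I$, which exists and is unique, has the form $G\cup H^*$, where $G$ and $H$ are sets of analytic polynomials and $H^*=\{h^*: h\in H\}$. -/

import Mathlib

namespace FreeStar

/-- The `2g` letters: `Sum.inl j` is `x_j` and `Sum.inr j` is its formal adjoint `x_j^*`. -/
abbrev Letter (g : ℕ) : Type := Fin g ⊕ Fin g

/-- The free monoid `⟨x, x^*⟩` of words in the `2g` letters; the empty word is `1`. -/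
abbrev Word (g : ℕ) : Type := FreeMonoid (Letter g)

/-- The free algebra `𝔽⟨x, x^*⟩`, realised as the monoid algebra of the free monoid of words. -/
abbrev Poly (𝔽 : Type*) [RCLike 𝔽] (g : ℕ) : Type _ := MonoidAlgebra 𝔽 (Word g)

/-- The adjoint of a word: reverse the word and exchange `x_j` with `x_j^*` in every letter. -/
def adjWord {g : ℕ} (w : Word g) : Word g :=
  FreeMonoid.ofList ((FreeMonoid.toList w).reverse.map Sum.swap)

/-- The involution of `𝔽⟨x, x^*⟩`: `(∑ c_w w)^* = ∑ conj(c_w) w^*`. -/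
noncomputable def adj {𝔽 : Type*} [RCLike 𝔽] {g : ℕ} (p : Poly 𝔽 g) : Poly 𝔽 g :=
  ∑ w ∈ p.coeff.support, MonoidAlgebra.single (adjWord w) (star (p.coeff w))

/-- A polynomial is analytic if none of the words occurring in it contains a letter `x_j^*`. -/
def IsAnalytic {𝔽 : Type*} [RCLike 𝔽] {g : ℕ} (p : Poly 𝔽 g) : Prop :=
  ∀ w ∈ p.coeff.support, ∀ l ∈ FreeMonoid.toList w, ∃ j : Fin g, l = Sum.inl j

/-- A `*`-ideal is a left ideal `I` (`Ideal` means left ideal) with `I^* = I`;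
such an ideal is automatically two-sided. -/
def IsStarIdeal {𝔽 : Type*} [RCLike 𝔽] {g : ℕ} (I : Ideal (Poly 𝔽 g)) : Prop :=
  adj '' (I : Set (Poly 𝔽 g)) = I

/-- The `*`-ideal generated by `P`: the intersection of all `*`-ideals containing `P`. -/
noncomputable def starIdealSpan {𝔽 : Type*} [RCLike 𝔽] {g : ℕ} (P : Set (Poly 𝔽 g)) : Ideal (Poly 𝔽 g) :=
  sInf {J : Ideal (Poly 𝔽 g) | IsStarIdeal J ∧ P ⊆ J}

/-- A monomial order: a (strict) total order on words that is a well ordering and is compatible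
with multiplication of words on both sides. -/
structure IsMonomialOrder {g : ℕ} (r : Word g → Word g → Prop) : Prop where
  isWellOrder : IsWellOrder (Word g) r
  mul_left : ∀ a b c : Word g, r a b → r (c * a) (c * b)
  mul_right : ∀ a b c : Word g, r a b → r (a * c) (b * c)

/-- The word `t` is the leading monomial of `p`: it occurs in `p`, and every other
word occurring in `p` is smaller. (No word is a leading monomial of `0`.) -/
def IsLeadingMonomial {𝔽 : Type*} [RCLike 𝔽] {g : ℕ} (r : Word g → Word g → Prop)
    (p : Poly 𝔽 g) (t : Word g) : Prop :=
  t ∈ p.coeff.support ∧ ∀ w ∈ p.coeff.support, w ≠ t → r w t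

/-- The word `a` divides the word `b` if `b = c a d` for some words `c`, `d`. -/
def WordDvd {g : ℕ} (a b : Word g) : Prop := ∃ c d : Word g, b = c * a * d

/-- `B` is a reduced Gröbner basis of the (two-sided) ideal `I` for the order `r`. -/
structure IsReducedGroebnerBasis {𝔽 : Type*} [RCLike 𝔽] {g : ℕ} (r : Word g → Word g → Prop)
    (I : Ideal (Poly 𝔽 g)) (B : Set (Poly 𝔽 g)) : Prop where
  subset : B ⊆ I
  /-- The leading monomial of every nonzero element of `I` is divisible by that of some
  element of `B`. -/
  exists_dvd : ∀ f ∈ I, f ≠ 0 → ∃ b ∈ B, ∃ s t : Word g,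
    IsLeadingMonomial r b s ∧ IsLeadingMonomial r f t ∧ WordDvd s t
  /-- Every element of `B` is monic. -/
  monic : ∀ b ∈ B, ∃ t : Word g, IsLeadingMonomial r b t ∧ b.coeff t = 1
  /-- For distinct elements of `B`, the leading monomial of one divides no term of the other. -/
  not_dvd : ∀ b₁ ∈ B, ∀ b₂ ∈ B, b₁ ≠ b₂ → ∀ t : Word g, IsLeadingMonomial r b₁ t →
    ∀ w ∈ b₂.coeff.support, ¬ WordDvd t w

end FreeStar

/-! Write `I` for the ideal and `purePart I s` for its elements in the letters `x_j` alone (`s =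
true`) or `x_j^*` alone (`s = false`). As `I` is generated by polynomials of these two kinds, the
quotient by `I` is the free product of the quotients of the two one-sided free algebras by the pure
parts. It should therefore have as basis the words divisible by no leading monomial of a pure part,
`normalWords`. Then every leading monomial of `I` is a multiple of one of a pure part
(`notMem_leadingWords`). A minimal one is a word `d` in letters of one side, and the basis element
belonging to it is `d` minus its normal form modulo the pure part, which uses the same letters
(`exists_mem_supported_of_mem_reducedBasis`).

Independence of the normal words modulo `I` is shown by van der Waerden's trick. The free algebra
acts on their span (`polyAction`), the pure parts act by zero (`polyAction_eq_zero`), and hence so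
does all of `I`. But a combination `f` of normal words sends `1` to `f` (`polyAction_apply_one`), so
`f ∈ I` forces `f = 0`. -/

namespace FreeStar

section

open MonoidAlgebra

variable {𝔽 : Type*} [RCLike 𝔽] {g : ℕ} {r : Word g → Word g → Prop}

/-! ### Monomial orders and divisibility of words -/

namespace IsMonomialOrder

theorem trans (hr : IsMonomialOrder r) {a b c : Word g} (hab : r a b) (hbc : r b c) : r a c :=
  haveI := hr.isWellOrder
  _root_.trans_of r hab hbc

theorem irrefl (hr : IsMonomialOrder r) (a : Word g) : ¬ r a a :=
  haveI := hr.isWellOrder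
  irrefl_of r a

theorem wellFounded (hr : IsMonomialOrder r) : WellFounded r :=
  haveI := hr.isWellOrder
  IsWellFounded.wf

theorem trichotomous (hr : IsMonomialOrder r) (a b : Word g) : r a b ∨ a = b ∨ r b a :=
  haveI := hr.isWellOrder
  trichotomous_of r a b

/-- If `m` is the least word below `1`, then `m * m` is below `m`, against minimality. -/
theorem not_rel_one (hr : IsMonomialOrder r) (w : Word g) : ¬ r w 1 := by
  intro hw
  obtain ⟨m, hm, hmin⟩ := hr.wellFounded.has_min {w | r w 1} ⟨w, hw⟩
  have h : r (m * m) m := by simpa using hr.mul_left m 1 m hm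
  exact hmin _ (hr.trans h hm) h

theorem one_eq_or_rel (hr : IsMonomialOrder r) (w : Word g) : 1 = w ∨ r 1 w := by
  rcases hr.trichotomous 1 w with h | h | h
  · exact Or.inr h
  · exact Or.inl h
  · exact absurd h (hr.not_rel_one w)

theorem not_rel_of_dvd (hr : IsMonomialOrder r) {a b : Word g} (h : WordDvd a b) : ¬ r b a := by
  obtain ⟨c, d, rfl⟩ := h
  have h1 : a = c * a ∨ r a (c * a) := by
    rcases hr.one_eq_or_rel c with h | h
    · left; simp [← h]
    · right; simpa using hr.mul_right _ _ a h
  have h2 : c * a = c * a * d ∨ r (c * a) (c * a * d) := by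
    rcases hr.one_eq_or_rel d with h | h
    · left; simp [← h]
    · right; simpa using hr.mul_left _ _ (c * a) h
  intro h
  rcases h1 with h1 | h1 <;> rcases h2 with h2 | h2
  · rw [← h2, ← h1] at h; exact hr.irrefl _ h
  · rw [← h1] at h2 h; exact hr.irrefl _ (hr.trans h2 h)
  · rw [← h2] at h; exact hr.irrefl _ (hr.trans h1 h)
  · exact hr.irrefl _ (hr.trans (hr.trans h1 h2) h)

end IsMonomialOrder

theorem WordDvd.refl (a : Word g) : WordDvd a a := ⟨1, 1, by simp⟩

theorem one_wordDvd (a : Word g) : WordDvd 1 a := ⟨1, a, by simp⟩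

theorem WordDvd.trans {a b c : Word g} (hab : WordDvd a b) (hbc : WordDvd b c) : WordDvd a c := by
  obtain ⟨x, y, rfl⟩ := hab
  obtain ⟨z, w, rfl⟩ := hbc
  exact ⟨z * x, y * w, by simp only [mul_assoc]⟩

theorem wordDvd_mul_left (a b : Word g) : WordDvd b (a * b) := ⟨a, 1, by simp⟩

theorem wordDvd_mul_right (a b : Word g) : WordDvd a (a * b) := ⟨1, b, by simp⟩

theorem WordDvd.length_le {a b : Word g} (h : WordDvd a b) : a.length ≤ b.length := by
  obtain ⟨c, d, rfl⟩ := h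
  simp only [FreeMonoid.length_mul]
  omega

theorem WordDvd.eq_of_length_le {a b : Word g} (h : WordDvd a b) (hl : b.length ≤ a.length) :
    a = b := by
  obtain ⟨c, d, rfl⟩ := h
  simp only [FreeMonoid.length_mul] at hl
  have hc : c = 1 := FreeMonoid.length_eq_zero.1 (by omega)
  have hd : d = 1 := FreeMonoid.length_eq_zero.1 (by omega)
  simp [hc, hd]

theorem WordDvd.antisymm {a b : Word g} (h : WordDvd a b) (h' : WordDvd b a) : a = b :=
  h.eq_of_length_le h'.length_le

/-! ### Leading words of a subspace and normal forms -/

theorem IsLeadingMonomial.unique (hr : IsMonomialOrder r) {f : Poly 𝔽 g} {s t : Word g}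
    (hs : IsLeadingMonomial r f s) (ht : IsLeadingMonomial r f t) : s = t := by
  by_contra h
  exact hr.irrefl _ (hr.trans (hs.2 t ht.1 (Ne.symm h)) (ht.2 s hs.1 h))

theorem exists_isLeadingMonomial (hr : IsMonomialOrder r) {f : Poly 𝔽 g} (hf : f ≠ 0) :
    ∃ t, IsLeadingMonomial r f t := by
  classical
  have := hr.isWellOrder
  let := linearOrderOfSTO r
  have hne : f.coeff.support.Nonempty := by
    rwa [Finsupp.support_nonempty_iff, Ne, coeff_eq_zero]
  exact ⟨f.coeff.support.max' hne, Finset.max'_mem _ _, fun w hw hne' =>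
    lt_of_le_of_ne (Finset.le_max' _ w hw) hne'⟩

theorem IsLeadingMonomial.mul (hr : IsMonomialOrder r) {f : Poly 𝔽 g} {t : Word g}
    (h : IsLeadingMonomial r f t) (a b : Word g) :
    IsLeadingMonomial r (single a 1 * f * single b 1) (a * t * b) := by
  have hsupp : ∀ w, w ∈ (single a 1 * f * single b 1 : Poly 𝔽 g).coeff.support ↔
      ∃ u ∈ f.coeff.support, a * u * b = w := by
    intro w
    rw [support_coeff_mul_single _ _ (by simp), support_coeff_single_mul _ _ (by simp)]
    simp
  refine ⟨(hsupp _).2 ⟨t, h.1, rfl⟩, fun w hw hne => ?_⟩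
  obtain ⟨u, hu, rfl⟩ := (hsupp w).1 hw
  exact hr.mul_right _ _ _ (hr.mul_left _ _ _ (h.2 u hu (by rintro rfl; exact hne rfl)))

/-- The leading monomials of the elements of a subspace. -/
def leadingWords (r : Word g → Word g → Prop) (W : Submodule 𝔽 (Poly 𝔽 g)) : Set (Word g) :=
  {t | ∃ f ∈ W, IsLeadingMonomial r f t}

theorem leadingWords_mono {W W' : Submodule 𝔽 (Poly 𝔽 g)} (h : W ≤ W') :
    leadingWords r W ⊆ leadingWords r W' :=
  fun _ ⟨f, hf, ht⟩ => ⟨f, h hf, ht⟩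

theorem eq_zero_of_mem_supported_compl (hr : IsMonomialOrder r) {W : Submodule 𝔽 (Poly 𝔽 g)}
    {f : Poly 𝔽 g} (hf : f ∈ W) (hs : f ∈ supported 𝔽 𝔽 (leadingWords r W)ᶜ) : f = 0 := by
  by_contra h
  obtain ⟨t, ht⟩ := exists_isLeadingMonomial hr h
  exact hs ht.1 ⟨f, hf, ht⟩

theorem single_mem_supported {S : Set (Word g)} {w : Word g} (hw : w ∈ S) :
    (single w 1 : Poly 𝔽 g) ∈ supported 𝔽 𝔽 S := by
  rw [supported_eq_span_single]
  exact Submodule.subset_span ⟨w, hw, rfl⟩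

theorem supported_le {S : Set (Word g)} {W : Submodule 𝔽 (Poly 𝔽 g)}
    (h : ∀ w ∈ S, (single w 1 : Poly 𝔽 g) ∈ W) : supported 𝔽 𝔽 S ≤ W := by
  rw [supported_eq_span_single, Submodule.span_le]
  rintro _ ⟨w, hw, rfl⟩
  exact h w hw

/-- Division by well-founded induction: a word in `D` is rewritten through an element of `W` that it
leads, leaving smaller words. A subset `D` is allowed because `notMem_leadingWords` uses this before
all leading monomials are known. -/
theorem single_mem_supported_sup (hr : IsMonomialOrder r) {W : Submodule 𝔽 (Poly 𝔽 g)}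
    {D : Set (Word g)} (hD : D ⊆ leadingWords r W) (t : Word g) :
    (single t 1 : Poly 𝔽 g) ∈ supported 𝔽 𝔽 (Dᶜ ∩ {w | w = t ∨ r w t}) ⊔ W := by
  classical
  induction t using hr.wellFounded.induction with
  | _ t ih =>
  by_cases ht : t ∈ D
  · obtain ⟨f, hf, hft⟩ := hD ht
    have hc : f.coeff t ≠ 0 := by simpa using hft.1
    have hlow : f.erase t ∈ supported 𝔽 𝔽 {w | r w t} := by
      intro w hw
      have hw' : w ∈ (f.coeff.erase t).support := hw
      rw [Finsupp.support_erase, Finset.mem_erase] at hw'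
      exact hft.2 w hw'.2 hw'.1
    have hle : supported 𝔽 𝔽 {w | r w t} ≤
        supported 𝔽 𝔽 (Dᶜ ∩ {w | w = t ∨ r w t}) ⊔ W := by
      refine supported_le fun w hw => ?_
      refine sup_le_sup_right (supported_mono ?_) W (ih w hw)
      rintro u ⟨hu, rfl | hu'⟩
      · exact ⟨hu, Or.inr hw⟩
      · exact ⟨hu, Or.inr (hr.trans hu' hw)⟩
    have hsum : (single t 1 : Poly 𝔽 g) = (f.coeff t)⁻¹ • (f - f.erase t) := by
      have h := single_add_erase t f
      rw [← eq_sub_iff_add_eq] at h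
      rw [← h, smul_single, smul_eq_mul, inv_mul_cancel₀ hc]
    rw [hsum]
    exact Submodule.smul_mem _ _ (Submodule.sub_mem _ (Submodule.mem_sup_right hf) (hle hlow))
  · exact Submodule.mem_sup_left (single_mem_supported ⟨ht, Or.inl rfl⟩)

theorem isCompl_supported_compl_leadingWords (hr : IsMonomialOrder r)
    (W : Submodule 𝔽 (Poly 𝔽 g)) :
    IsCompl (supported 𝔽 𝔽 (leadingWords r W)ᶜ) W := by
  constructor
  · rw [Submodule.disjoint_def]
    exact fun f hs hf => eq_zero_of_mem_supported_compl hr hf hs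
  · rw [codisjoint_iff, eq_top_iff]
    intro f _
    have hle : supported 𝔽 𝔽 (Set.univ : Set (Word g)) ≤
        supported 𝔽 𝔽 (leadingWords r W)ᶜ ⊔ W :=
      supported_le fun w _ => sup_le_sup_right (supported_mono Set.inter_subset_left) W
        (single_mem_supported_sup hr subset_rfl w)
    exact hle fun _ _ => trivial

/-- The normal form modulo `W`: the projection along `W` to the span of the words which are not
leading monomials of elements of `W`. -/
noncomputable def normalForm (hr : IsMonomialOrder r) (W : Submodule 𝔽 (Poly 𝔽 g)) :
    Poly 𝔽 g →ₗ[𝔽] Poly 𝔽 g :=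
  Submodule.projection _ _ (isCompl_supported_compl_leadingWords hr W)

section NormalForm

variable (hr : IsMonomialOrder r) {W : Submodule 𝔽 (Poly 𝔽 g)}

theorem normalForm_mem (f : Poly 𝔽 g) :
    normalForm hr W f ∈ supported 𝔽 𝔽 (leadingWords r W)ᶜ :=
  Submodule.projection_apply_mem _ f

theorem normalForm_of_mem_supported {f : Poly 𝔽 g}
    (hf : f ∈ supported 𝔽 𝔽 (leadingWords r W)ᶜ) : normalForm hr W f = f :=
  Submodule.projection_apply_left _ ⟨f, hf⟩

theorem normalForm_of_mem {f : Poly 𝔽 g} (hf : f ∈ W) : normalForm hr W f = 0 :=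
  (Submodule.projection_apply_eq_zero_iff _).2 hf

theorem sub_normalForm_mem (f : Poly 𝔽 g) : f - normalForm hr W f ∈ W := by
  rw [← Submodule.projection_apply_eq_zero_iff
    (isCompl_supported_compl_leadingWords hr W), map_sub, sub_eq_zero]
  exact (normalForm_of_mem_supported hr (normalForm_mem hr f)).symm

theorem normalForm_congr {f f' : Poly 𝔽 g} (h : f - f' ∈ W) :
    normalForm hr W f = normalForm hr W f' := by
  rw [← sub_eq_zero, ← map_sub, normalForm_of_mem hr h]

theorem normalForm_single_mem (t : Word g) :
    normalForm hr W (single t 1) ∈ supported 𝔽 𝔽 {w | w = t ∨ r w t} := by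
  obtain ⟨n, hn, w, hw, h⟩ := Submodule.mem_sup.1
    (single_mem_supported_sup hr (W := W) subset_rfl t)
  rw [← h, map_add, normalForm_of_mem hr hw, add_zero, normalForm_of_mem_supported]
  · exact supported_mono Set.inter_subset_right hn
  · exact supported_mono Set.inter_subset_left hn

end NormalForm

/-! ### The reduced Gröbner basis of a two-sided ideal -/

theorem mem_leadingWords_of_dvd (hr : IsMonomialOrder r) {I : Ideal (Poly 𝔽 g)} [I.IsTwoSided]
    {s t : Word g} (hs : s ∈ leadingWords r (I.restrictScalars 𝔽)) (h : WordDvd s t) :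
    t ∈ leadingWords r (I.restrictScalars 𝔽) := by
  obtain ⟨a, b, rfl⟩ := h
  obtain ⟨f, hf, hl⟩ := hs
  exact ⟨_, I.mul_mem_right _ (I.mul_mem_left _ hf), hl.mul hr a b⟩

/-- The leading monomials of an ideal which are minimal with respect to divisibility. -/
def minimalLeadingWords (r : Word g → Word g → Prop) (I : Ideal (Poly 𝔽 g)) : Set (Word g) :=
  {t | t ∈ leadingWords r (I.restrictScalars 𝔽) ∧
    ∀ s ∈ leadingWords r (I.restrictScalars 𝔽), WordDvd s t → s = t}

/-- `b` is the monic element of `I` with leading monomial `t` whose other words are not leading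
monomials of elements of `I`. -/
structure IsReducedElement (r : Word g → Word g → Prop) (I : Ideal (Poly 𝔽 g)) (t : Word g)
    (b : Poly 𝔽 g) : Prop where
  mem : b ∈ I
  coeff_eq_one : b.coeff t = 1
  of_ne : ∀ w ∈ b.coeff.support, w ≠ t → r w t ∧ w ∉ leadingWords r (I.restrictScalars 𝔽)

/-- The reduced elements of `I` whose leading monomials are minimal. -/
def reducedBasis (r : Word g → Word g → Prop) (I : Ideal (Poly 𝔽 g)) : Set (Poly 𝔽 g) :=
  {b | ∃ t ∈ minimalLeadingWords r I, IsReducedElement r I t b}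

theorem IsReducedElement.isLeadingMonomial {I : Ideal (Poly 𝔽 g)} {t : Word g} {b : Poly 𝔽 g}
    (h : IsReducedElement r I t b) : IsLeadingMonomial r b t :=
  ⟨by simp [h.coeff_eq_one], fun w hw hne => (h.of_ne w hw hne).1⟩

theorem IsReducedElement.unique (hr : IsMonomialOrder r) {I : Ideal (Poly 𝔽 g)} {t : Word g}
    {b b' : Poly 𝔽 g} (h : IsReducedElement r I t b) (h' : IsReducedElement r I t b') :
    b = b' := by
  rw [← sub_eq_zero]
  refine eq_zero_of_mem_supported_compl hr (W := I.restrictScalars 𝔽) (I.sub_mem h.mem h'.mem) ?_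
  intro w hw hw'
  have hw0 : b.coeff w - b'.coeff w ≠ 0 := by simpa using hw
  have hwt : w ≠ t := by
    rintro rfl
    simp [h.coeff_eq_one, h'.coeff_eq_one] at hw0
  by_cases hb : b.coeff w = 0
  · have hb' : b'.coeff w ≠ 0 := by
      intro h0
      simp [hb, h0] at hw0
    exact (h'.of_ne w (by simpa using hb') hwt).2 hw'
  · exact (h.of_ne w (by simpa using hb) hwt).2 hw'

theorem isReducedElement_single_sub {I : Ideal (Poly 𝔽 g)} {t : Word g} {n : Poly 𝔽 g}
    (hmem : single t 1 - n ∈ I) (hn : ∀ w ∈ n.coeff.support,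
      r w t ∧ w ∉ leadingWords r (I.restrictScalars 𝔽)) (htn : n.coeff t = 0) :
    IsReducedElement r I t (single t 1 - n) where
  mem := hmem
  coeff_eq_one := by simp [htn]
  of_ne w hw hne := hn w (by
    simpa [Finsupp.single_apply, hne.symm] using hw)

theorem single_sub_normalForm_support (hr : IsMonomialOrder r) {W : Submodule 𝔽 (Poly 𝔽 g)}
    {t : Word g} (ht : t ∈ leadingWords r W) {w : Word g}
    (hw : w ∈ (normalForm hr W (single t 1)).coeff.support) : r w t ∧ w ∉ leadingWords r W := by
  have h1 : w ∉ leadingWords r W := normalForm_mem hr _ hw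
  refine ⟨?_, h1⟩
  rcases normalForm_single_mem hr t hw with h | h
  · exact absurd (h ▸ ht) h1
  · exact h

theorem coeff_normalForm_eq_zero (hr : IsMonomialOrder r) {W : Submodule 𝔽 (Poly 𝔽 g)}
    {t : Word g} (ht : t ∈ leadingWords r W) (f : Poly 𝔽 g) : (normalForm hr W f).coeff t = 0 := by
  by_contra h
  exact normalForm_mem hr f (Finset.mem_coe.2 (Finsupp.mem_support_iff.2 h)) ht

theorem exists_isReducedElement (hr : IsMonomialOrder r) {I : Ideal (Poly 𝔽 g)} {t : Word g}
    (ht : t ∈ leadingWords r (I.restrictScalars 𝔽)) : ∃ b, IsReducedElement r I t b :=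
  ⟨_, isReducedElement_single_sub (sub_normalForm_mem hr (W := I.restrictScalars 𝔽) (single t 1))
    (fun _ hw => single_sub_normalForm_support hr ht hw) (coeff_normalForm_eq_zero hr ht _)⟩

theorem exists_minimalLeadingWord {I : Ideal (Poly 𝔽 g)} {t : Word g}
    (ht : t ∈ leadingWords r (I.restrictScalars 𝔽)) :
    ∃ s ∈ minimalLeadingWords r I, WordDvd s t := by
  induction hn : t.length using Nat.strong_induction_on generalizing t with
  | _ n ih =>
  by_cases h : ∀ s ∈ leadingWords r (I.restrictScalars 𝔽), WordDvd s t → s = t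
  · exact ⟨t, ⟨ht, h⟩, WordDvd.refl t⟩
  · push Not at h
    obtain ⟨s, hs, hst, hne⟩ := h
    have hlt : s.length < n := by
      by_contra hle
      exact hne (hst.eq_of_length_le (by omega))
    obtain ⟨u, hu, hus⟩ := ih _ hlt hs rfl
    exact ⟨u, hu, hus.trans hst⟩

theorem isReducedGroebnerBasis_reducedBasis (hr : IsMonomialOrder r) (I : Ideal (Poly 𝔽 g))
    [I.IsTwoSided] :
    IsReducedGroebnerBasis r I (reducedBasis r I) where
  subset := fun _ ⟨_, _, h⟩ => h.mem
  exists_dvd f hf hf0 := by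
    obtain ⟨t, ht⟩ := exists_isLeadingMonomial hr hf0
    obtain ⟨s, hs, hst⟩ := exists_minimalLeadingWord (I := I) ⟨f, hf, ht⟩
    obtain ⟨b, hb⟩ := exists_isReducedElement hr hs.1
    exact ⟨b, ⟨s, hs, hb⟩, s, t, hb.isLeadingMonomial, ht, hst⟩
  monic := fun b ⟨t, _, h⟩ => ⟨t, h.isLeadingMonomial, h.coeff_eq_one⟩
  not_dvd := by
    rintro b₁ ⟨t₁, ht₁, h₁⟩ b₂ ⟨t₂, ht₂, h₂⟩ hne t ht w hw hd
    obtain rfl := ht.unique hr h₁.isLeadingMonomial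
    by_cases hwt : w = t₂
    · subst hwt
      obtain rfl := ht₂.2 t ht₁.1 hd
      exact hne (h₁.unique hr h₂)
    · exact (h₂.of_ne w hw hwt).2 (mem_leadingWords_of_dvd hr ht₁.1 hd)

theorem IsReducedGroebnerBasis.eq_reducedBasis (hr : IsMonomialOrder r) {I : Ideal (Poly 𝔽 g)}
    [I.IsTwoSided] {B : Set (Poly 𝔽 g)} (hB : IsReducedGroebnerBasis r I B) :
    B = reducedBasis r I := by
  have key : ∀ b ∈ B, ∀ t, IsLeadingMonomial r b t → b.coeff t = 1 →
      t ∈ minimalLeadingWords r I ∧ IsReducedElement r I t b := by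
    intro b hb t ht h1
    -- The element of `B` whose leading monomial divides `s` must be `b` itself, by `not_dvd`. This
    -- yields both the minimality of `t` and the reducedness of the lower words.
    have hdvd : ∀ s ∈ leadingWords r (I.restrictScalars 𝔽), ∀ w ∈ b.coeff.support,
        WordDvd s w → WordDvd t s := by
      rintro s ⟨f, hf, hfs⟩ w hw hsw
      have hf0 : f ≠ 0 := by
        rintro rfl
        simpa using hfs.1
      obtain ⟨b', hb', u, s', hu, hs', hus⟩ := hB.exists_dvd f hf hf0
      obtain rfl := hs'.unique hr hfs
      by_cases hbb : b' = b
      · subst hbb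
        rwa [ht.unique hr hu]
      · exact absurd (hus.trans hsw) (hB.not_dvd b' hb' b hb hbb u hu w hw)
    refine ⟨⟨⟨b, hB.subset hb, ht⟩, fun s hs hst => hst.antisymm (hdvd s hs t ht.1 hst)⟩,
      ⟨hB.subset hb, h1, fun w hw hne => ⟨ht.2 w hw hne, fun hwl => ?_⟩⟩⟩
    exact hr.not_rel_of_dvd (hdvd w hwl w hw (WordDvd.refl w)) (ht.2 w hw hne)
  ext b
  constructor
  · intro hb
    obtain ⟨t, ht, h1⟩ := hB.monic b hb
    exact ⟨t, key b hb t ht h1⟩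
  · rintro ⟨t, ht, hbt⟩
    obtain ⟨b', hb', s, t', hs, ht', hst⟩ := hB.exists_dvd b hbt.mem (by
      rintro rfl
      simpa using hbt.coeff_eq_one)
    obtain rfl := ht'.unique hr hbt.isLeadingMonomial
    obtain rfl := ht.2 s ⟨b', hB.subset hb', hs⟩ hst
    obtain ⟨u, hu, h1⟩ := hB.monic b' hb'
    obtain rfl := hu.unique hr hs
    rwa [hbt.unique hr (key b' hb' u hu h1).2]

/-! ### Words in the letters of one side -/

/-- The words in the letters `x_j` (`s = true`), or in the letters `x_j^*` (`s = false`). -/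
def pureWords (g : ℕ) (s : Bool) : Set (Word g) :=
  {w | ∀ l ∈ FreeMonoid.toList w, l.isLeft = s}

theorem of_mem_pureWords (l : Letter g) : FreeMonoid.of l ∈ pureWords g l.isLeft := by
  rintro _ (_ | ⟨_, ⟨⟩⟩)
  rfl

theorem mul_mem_pureWords {s : Bool} {a b : Word g} :
    a * b ∈ pureWords g s ↔ a ∈ pureWords g s ∧ b ∈ pureWords g s := by
  simp only [pureWords, Set.mem_ofPred_eq, FreeMonoid.toList_mul, List.mem_append]
  grind

theorem mem_pureWords_of_dvd {s : Bool} {a b : Word g} (h : WordDvd a b)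
    (hb : b ∈ pureWords g s) : a ∈ pureWords g s := by
  obtain ⟨c, d, rfl⟩ := h
  exact (mul_mem_pureWords.1 (mul_mem_pureWords.1 hb).1).2

theorem eq_one_of_mem_pureWords {s s' : Bool} (hne : s ≠ s') {a : Word g}
    (h : a ∈ pureWords g s) (h' : a ∈ pureWords g s') : a = 1 := by
  apply FreeMonoid.toList.injective
  rw [FreeMonoid.toList_one, List.eq_nil_iff_forall_not_mem]
  exact fun l hl => hne ((h l hl).symm.trans (h' l hl))

/-- The longest prefix of a word in the letters of side `s`. -/
def purePrefix (s : Bool) (w : Word g) : Word g :=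
  FreeMonoid.ofList ((FreeMonoid.toList w).takeWhile fun l => l.isLeft == s)

/-- The complement of the longest prefix of a word in the letters of side `s`. -/
def pureRest (s : Bool) (w : Word g) : Word g :=
  FreeMonoid.ofList ((FreeMonoid.toList w).dropWhile fun l => l.isLeft == s)

theorem purePrefix_mul_pureRest (s : Bool) (w : Word g) : purePrefix s w * pureRest s w = w := by
  rw [purePrefix, pureRest, ← FreeMonoid.ofList_append, List.takeWhile_append_dropWhile,
    FreeMonoid.ofList_toList]

theorem purePrefix_mem (s : Bool) (w : Word g) : purePrefix s w ∈ pureWords g s := by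
  intro l hl
  simpa using List.mem_takeWhile_imp hl

theorem purePrefix_pureRest (s : Bool) (w : Word g) : purePrefix s (pureRest s w) = 1 := by
  apply FreeMonoid.toList.injective
  simp only [purePrefix, pureRest, FreeMonoid.toList_ofList, FreeMonoid.toList_one]
  rw [List.takeWhile_eq_nil_iff]
  intro hl
  exact List.dropWhile_get_zero_not _ _ hl

theorem purePrefix_mul {s : Bool} {u v : Word g} (hu : u ∈ pureWords g s)
    (hv : purePrefix s v = 1) : purePrefix s (u * v) = u := by
  have hv' : ((FreeMonoid.toList v).takeWhile fun l => l.isLeft == s) = [] := hv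
  rw [purePrefix, FreeMonoid.toList_mul,
    List.takeWhile_append_of_pos (fun l hl => by simpa using hu l hl), hv', List.append_nil,
    FreeMonoid.ofList_toList]

theorem pureRest_mul {s : Bool} {u v : Word g} (hu : u ∈ pureWords g s)
    (hv : purePrefix s v = 1) : pureRest s (u * v) = v := by
  have h := purePrefix_mul_pureRest s (u * v)
  rw [purePrefix_mul hu hv] at h
  exact mul_left_cancel h

/-- A word in the letters of one side dividing `u * v`, where `v` does not start with a letter of
the side of `u`, divides `u` or `v`. -/
theorem dvd_or_dvd_of_mem_pureWords {s s' : Bool} {d u v : Word g} (hd : d ∈ pureWords g s')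
    (hu : u ∈ pureWords g s) (hv : purePrefix s v = 1) (h : WordDvd d (u * v)) :
    WordDvd d u ∨ WordDvd d v := by
  obtain ⟨a, b, h⟩ := h
  rw [mul_assoc] at h
  rcases List.append_eq_append_iff.1 (congrArg FreeMonoid.toList h : FreeMonoid.toList u ++
      FreeMonoid.toList v = FreeMonoid.toList a ++ FreeMonoid.toList (d * b)) with
    ⟨e, -, he⟩ | ⟨e, hae, hde⟩
  · right
    exact ⟨FreeMonoid.ofList e, b, by rw [mul_assoc]; exact he⟩
  rcases List.append_eq_append_iff.1 (hde : FreeMonoid.toList d ++ FreeMonoid.toList b =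
      e ++ FreeMonoid.toList v) with ⟨k, hk, -⟩ | ⟨k, hk, hkv⟩
  · left
    refine ⟨a, FreeMonoid.ofList k, ?_⟩
    rw [mul_assoc]
    exact hae.trans (congrArg (FreeMonoid.toList a ++ ·) hk)
  · rcases k with _ | ⟨l, k⟩
    · left
      refine ⟨a, 1, ?_⟩
      rw [mul_one]
      exact hae.trans (congrArg (FreeMonoid.toList a ++ ·) (by simpa using hk.symm))
    rcases e with _ | ⟨m, e⟩
    · right
      refine ⟨1, b, ?_⟩
      rw [one_mul]
      exact hkv.trans (congrArg (· ++ FreeMonoid.toList b) (by simpa using hk.symm))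
    -- Here `d` straddles the boundary: `m` lies in `u` and `l` is the first letter of `v`. Both lie
    -- on the side of `d`, so `v` starts with a letter of side `s`.
    exfalso
    have hl : l.isLeft = s' := hd l (by rw [hk]; simp)
    have hm : m.isLeft = s' := hd m (by rw [hk]; simp)
    have hm' : m.isLeft = s := hu m (by
      have := congrArg (m ∈ ·) hae
      simpa using this)
    have hv' : ((FreeMonoid.toList v).takeWhile fun l => l.isLeft == s) = [] := hv
    rw [hkv] at hv'
    simp [hl, ← hm, hm'] at hv'

/-! ### Elements of an ideal in the letters of one side -/

/-- The elements of an ideal which are polynomials in the letters of side `s`. -/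
noncomputable def purePart (I : Ideal (Poly 𝔽 g)) (s : Bool) : Submodule 𝔽 (Poly 𝔽 g) :=
  I.restrictScalars 𝔽 ⊓ supported 𝔽 𝔽 (pureWords g s)

theorem mul_mem_supported_pureWords {s : Bool} {p q : Poly 𝔽 g}
    (hp : p ∈ supported 𝔽 𝔽 (pureWords g s)) (hq : q ∈ supported 𝔽 𝔽 (pureWords g s)) :
    p * q ∈ supported 𝔽 𝔽 (pureWords g s) := by
  classical
  intro w hw
  obtain ⟨a, ha, b, hb, rfl⟩ := Finset.mem_mul.1 (support_coeff_mul_subset p q hw)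
  exact mul_mem_pureWords.2 ⟨hp ha, hq hb⟩

variable {I : Ideal (Poly 𝔽 g)}

theorem leadingWords_purePart_subset {s : Bool} :
    leadingWords r (purePart I s) ⊆ pureWords g s :=
  fun _ ⟨_, hf, ht⟩ => hf.2 ht.1

theorem mem_leadingWords_purePart_of_dvd (hr : IsMonomialOrder r) [I.IsTwoSided] {s : Bool}
    {a b : Word g} (ha : a ∈ leadingWords r (purePart I s)) (h : WordDvd a b)
    (hb : b ∈ pureWords g s) : b ∈ leadingWords r (purePart I s) := by
  obtain ⟨c, d, rfl⟩ := h
  obtain ⟨⟨hc, -⟩, hd⟩ := mul_mem_pureWords.1 hb |>.imp_left mul_mem_pureWords.1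
  obtain ⟨f, ⟨hf, hf'⟩, hl⟩ := ha
  exact ⟨_, ⟨I.mul_mem_right _ (I.mul_mem_left _ hf), mul_mem_supported_pureWords
    (mul_mem_supported_pureWords (single_mem_supported hc) hf') (single_mem_supported hd)⟩,
    hl.mul hr c d⟩

theorem normalForm_purePart_mem (hr : IsMonomialOrder r) {s : Bool} {f : Poly 𝔽 g}
    (hf : f ∈ supported 𝔽 𝔽 (pureWords g s)) :
    normalForm hr (purePart I s) f ∈ supported 𝔽 𝔽 (pureWords g s) := by
  rw [← sub_sub_cancel f (normalForm hr (purePart I s) f)]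
  exact Submodule.sub_mem _ hf (sub_normalForm_mem hr (W := purePart I s) f).2

/-- The words which are divisible by no leading monomial of an element of the ideal in the letters
of one side. -/
def normalWords (r : Word g → Word g → Prop) (I : Ideal (Poly 𝔽 g)) : Set (Word g) :=
  {w | ∀ s, ∀ d ∈ leadingWords r (purePart I s), ¬ WordDvd d w}

theorem mem_normalWords_of_dvd {a b : Word g} (h : WordDvd a b) (hb : b ∈ normalWords r I) :
    a ∈ normalWords r I :=
  fun s d hd hda => hb s d hd (hda.trans h)

theorem notMem_leadingWords_of_mem_normalWords {w : Word g} (hw : w ∈ normalWords r I)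
    (s : Bool) : w ∉ leadingWords r (purePart I s) :=
  fun h => hw s w h (WordDvd.refl w)

theorem mul_mem_normalWords (hr : IsMonomialOrder r) [I.IsTwoSided] {s : Bool} {u v : Word g}
    (hu : u ∈ pureWords g s) (hu' : u ∉ leadingWords r (purePart I s))
    (hv : purePrefix s v = 1) (hv' : v ∈ normalWords r I) : u * v ∈ normalWords r I := by
  intro s' d hd hdvd
  rcases dvd_or_dvd_of_mem_pureWords (leadingWords_purePart_subset hd) hu hv hdvd with h | h
  · by_cases hs : s' = s
    · subst hs
      exact hu' (mem_leadingWords_purePart_of_dvd hr hd h hu)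
    -- A divisor of `u` from the other side is empty, so it divides `v` too.
    · obtain rfl := eq_one_of_mem_pureWords hs (leadingWords_purePart_subset hd)
        (mem_pureWords_of_dvd h hu)
      exact hv' s' 1 hd (one_wordDvd v)
  · exact hv' s' d hd h

/-! ### The action on the span of the normal words -/

/-- The action of a letter: multiply by the letter from the left and replace the longest prefix in
the letters of its side by its normal form. -/
noncomputable def letterAction (hr : IsMonomialOrder r) (I : Ideal (Poly 𝔽 g)) (l : Letter g) :
    Poly 𝔽 g →ₗ[𝔽] Poly 𝔽 g :=
  (MonoidAlgebra.basis (Word g) 𝔽).constr 𝔽 fun w =>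
    normalForm hr (purePart I l.isLeft)
      (single (FreeMonoid.of l * purePrefix l.isLeft w) 1) * single (pureRest l.isLeft w) 1

theorem letterAction_single (hr : IsMonomialOrder r) (I : Ideal (Poly 𝔽 g)) (l : Letter g)
    (w : Word g) : letterAction hr I l (single w 1) = normalForm hr (purePart I l.isLeft)
      (single (FreeMonoid.of l * purePrefix l.isLeft w) 1) * single (pureRest l.isLeft w) 1 := by
  rw [← MonoidAlgebra.basis_apply, letterAction, Module.Basis.constr_basis]

theorem eqOn_supported {S : Set (Word g)} {φ ψ : Poly 𝔽 g →ₗ[𝔽] Poly 𝔽 g}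
    (h : ∀ w ∈ S, φ (single w 1) = ψ (single w 1)) {f : Poly 𝔽 g} (hf : f ∈ supported 𝔽 𝔽 S) :
    φ f = ψ f :=
  supported_le (W := LinearMap.eqLocus φ ψ) h hf

/-- The definition extended linearly in the prefix, so that it applies to the output of an earlier
letter of the same side. -/
theorem letterAction_mul_single (hr : IsMonomialOrder r) (I : Ideal (Poly 𝔽 g)) (l : Letter g)
    {v : Word g} (hv : purePrefix l.isLeft v = 1) {q : Poly 𝔽 g}
    (hq : q ∈ supported 𝔽 𝔽 (pureWords g l.isLeft)) :
    letterAction hr I l (q * single v 1) =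
      normalForm hr (purePart I l.isLeft) (single (FreeMonoid.of l) 1 * q) * single v 1 := by
  refine eqOn_supported (φ := letterAction hr I l ∘ₗ LinearMap.mulRight 𝔽 (single v 1))
    (ψ := LinearMap.mulRight 𝔽 (single v 1) ∘ₗ normalForm hr (purePart I l.isLeft) ∘ₗ
      LinearMap.mulLeft 𝔽 (single (FreeMonoid.of l) 1)) (fun u hu => ?_) hq
  simp only [LinearMap.comp_apply, LinearMap.mulRight_apply, LinearMap.mulLeft_apply,
    single_mul_single, mul_one]
  rw [letterAction_single, purePrefix_mul hu hv, pureRest_mul hu hv]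

theorem mul_single_mem_supported_normalWords (hr : IsMonomialOrder r) [I.IsTwoSided] {s : Bool}
    {v : Word g} (hv : purePrefix s v = 1) (hv' : v ∈ normalWords r I) {f : Poly 𝔽 g}
    (hf : f ∈ supported 𝔽 𝔽 (pureWords g s)) :
    normalForm hr (purePart I s) f * single v 1 ∈ supported 𝔽 𝔽 (normalWords r I) := by
  classical
  intro w hw
  obtain ⟨u, hu, v', hv'', rfl⟩ := Finset.mem_mul.1 (support_coeff_mul_subset _ _ hw)
  obtain rfl : v' = v := by
    simpa using hv''
  exact mul_mem_normalWords hr (normalForm_purePart_mem hr hf hu) (normalForm_mem hr f hu) hv hv'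

theorem letterAction_mem (hr : IsMonomialOrder r) [I.IsTwoSided] (l : Letter g) {f : Poly 𝔽 g}
    (hf : f ∈ supported 𝔽 𝔽 (normalWords r I)) :
    letterAction hr I l f ∈ supported 𝔽 𝔽 (normalWords r I) := by
  refine supported_le (W := (supported 𝔽 𝔽 (normalWords r I)).comap (letterAction hr I l))
    (fun w hw => ?_) hf
  rw [Submodule.mem_comap, letterAction_single]
  refine mul_single_mem_supported_normalWords hr (purePrefix_pureRest _ w)
    (mem_normalWords_of_dvd ?_ hw) (single_mem_supported ?_)
  · conv_rhs => rw [← purePrefix_mul_pureRest l.isLeft w]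
    exact wordDvd_mul_left _ _
  · exact mul_mem_pureWords.2 ⟨of_mem_pureWords l, purePrefix_mem _ w⟩

/-- The action of the free algebra extending `letterAction`. -/
noncomputable def polyAction (hr : IsMonomialOrder r) (I : Ideal (Poly 𝔽 g)) :
    Poly 𝔽 g →ₐ[𝔽] Module.End 𝔽 (Poly 𝔽 g) :=
  MonoidAlgebra.lift 𝔽 _ _ (FreeMonoid.lift (letterAction hr I))

theorem polyAction_single_one (hr : IsMonomialOrder r) (I : Ideal (Poly 𝔽 g)) (f : Poly 𝔽 g) :
    polyAction hr I (single 1 1) f = f := by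
  simp [polyAction]

theorem polyAction_single_of_mul (hr : IsMonomialOrder r) (I : Ideal (Poly 𝔽 g)) (l : Letter g)
    (w : Word g) (f : Poly 𝔽 g) : polyAction hr I (single (FreeMonoid.of l * w) 1) f =
      letterAction hr I l (polyAction hr I (single w 1) f) := by
  simp [polyAction]

theorem polyAction_mem (hr : IsMonomialOrder r) [I.IsTwoSided] (p : Poly 𝔽 g) {f : Poly 𝔽 g}
    (hf : f ∈ supported 𝔽 𝔽 (normalWords r I)) :
    polyAction hr I p f ∈ supported 𝔽 𝔽 (normalWords r I) := by
  have hp : p ∈ supported 𝔽 𝔽 (Set.univ : Set (Word g)) := fun _ _ => trivial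
  refine supported_le (W := (supported 𝔽 𝔽 (normalWords r I)).comap
    ((polyAction hr I).toLinearMap.flip f)) (fun w _ => ?_) hp
  rw [Submodule.mem_comap, LinearMap.flip_apply, AlgHom.toLinearMap_apply]
  induction w using FreeMonoid.inductionOn' with
  | one => rwa [polyAction_single_one]
  | of_mul l w ih =>
    rw [polyAction_single_of_mul]
    exact letterAction_mem hr l (ih trivial)

/-- Intermediate normal forms can be dropped: each changes its argument by an element of the pure
part, and multiplying by a letter of the same side keeps that difference there. -/
theorem polyAction_mul_single (hr : IsMonomialOrder r) [I.IsTwoSided] {s : Bool}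
    {p q : Poly 𝔽 g} (hp : p ∈ supported 𝔽 𝔽 (pureWords g s))
    (hq : q ∈ supported 𝔽 𝔽 (pureWords g s)) {v : Word g} (hv : purePrefix s v = 1) :
    polyAction hr I p (normalForm hr (purePart I s) q * single v 1) =
      normalForm hr (purePart I s) (p * q) * single v 1 := by
  refine eqOn_supported (φ := (polyAction hr I).toLinearMap.flip
      (normalForm hr (purePart I s) q * single v 1))
    (ψ := LinearMap.mulRight 𝔽 (single v 1) ∘ₗ normalForm hr (purePart I s) ∘ₗ
      LinearMap.mulRight 𝔽 q) (fun a ha => ?_) hp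
  simp only [LinearMap.comp_apply, LinearMap.mulRight_apply, LinearMap.flip_apply,
    AlgHom.toLinearMap_apply]
  induction a using FreeMonoid.inductionOn' with
  | one => rw [polyAction_single_one, ← one_def, one_mul]
  | of_mul l a ih =>
    obtain ⟨hl, ha⟩ := mul_mem_pureWords.1 ha
    obtain rfl : l.isLeft = s := hl l (by simp)
    have haq : single a 1 * q ∈ supported 𝔽 𝔽 (pureWords g l.isLeft) :=
      mul_mem_supported_pureWords (single_mem_supported ha) hq
    rw [polyAction_single_of_mul, ih ha,
      letterAction_mul_single hr I l hv (normalForm_purePart_mem hr haq)]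
    congr 1
    apply normalForm_congr
    have h : (single (FreeMonoid.of l * a) 1 : Poly 𝔽 g) =
        single (FreeMonoid.of l) 1 * single a 1 := by rw [single_mul_single, one_mul]
    rw [h, mul_assoc, ← mul_sub, ← neg_sub, mul_neg]
    have hsub := sub_normalForm_mem hr (W := purePart I l.isLeft) (single a 1 * q)
    exact Submodule.neg_mem _ ⟨I.mul_mem_left _ hsub.1,
      mul_mem_supported_pureWords (single_mem_supported hl) hsub.2⟩

/-- The prefix of a normal word is its own normal form, so `p` turns it into the normal form of `p`
times the prefix, an element of the pure part. -/
theorem polyAction_eq_zero (hr : IsMonomialOrder r) [I.IsTwoSided] {s : Bool} {p : Poly 𝔽 g}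
    (hp : p ∈ purePart I s) {f : Poly 𝔽 g} (hf : f ∈ supported 𝔽 𝔽 (normalWords r I)) :
    polyAction hr I p f = 0 := by
  refine eqOn_supported (φ := polyAction hr I p) (ψ := 0) (fun w hw => ?_) hf
  have hpre : (single (purePrefix s w) 1 : Poly 𝔽 g) ∈ supported 𝔽 𝔽 (pureWords g s) :=
    single_mem_supported (purePrefix_mem s w)
  have hdvd : WordDvd (purePrefix s w) w := by
    conv_rhs => rw [← purePrefix_mul_pureRest s w]
    exact wordDvd_mul_right _ _
  have hnf : normalForm hr (purePart I s) (single (purePrefix s w) 1) =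
      single (purePrefix s w) 1 :=
    normalForm_of_mem_supported hr (single_mem_supported
      (notMem_leadingWords_of_mem_normalWords (mem_normalWords_of_dvd hdvd hw) s))
  have hw' : (single w 1 : Poly 𝔽 g) = normalForm hr (purePart I s) (single (purePrefix s w) 1) *
      single (pureRest s w) 1 := by
    rw [hnf, single_mul_single, purePrefix_mul_pureRest, one_mul]
  rw [hw', polyAction_mul_single hr hp.2 hpre (purePrefix_pureRest s w), normalForm_of_mem,
    zero_mul, LinearMap.zero_apply]
  exact ⟨I.mul_mem_right _ hp.1, mul_mem_supported_pureWords hp.2 hpre⟩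

/-- The letters of a normal word act from right to left. Its divisors are normal, so no normal form
changes anything and the word is rebuilt. -/
theorem polyAction_apply_one (hr : IsMonomialOrder r) {f : Poly 𝔽 g}
    (hf : f ∈ supported 𝔽 𝔽 (normalWords r I)) : polyAction hr I f 1 = f := by
  refine eqOn_supported (φ := (polyAction hr I).toLinearMap.flip 1) (ψ := LinearMap.id)
    (fun w hw => ?_) hf
  rw [LinearMap.flip_apply, AlgHom.toLinearMap_apply, LinearMap.id_apply]
  induction w using FreeMonoid.inductionOn' with
  | one => rw [polyAction_single_one, one_def]
  | of_mul l w ih =>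
    rw [polyAction_single_of_mul, ih (mem_normalWords_of_dvd (wordDvd_mul_left _ _) hw),
      letterAction_single, normalForm_of_mem_supported, single_mul_single, mul_assoc,
      purePrefix_mul_pureRest, one_mul]
    apply single_mem_supported
    refine notMem_leadingWords_of_mem_normalWords (mem_normalWords_of_dvd ?_ hw) _
    conv_rhs => rw [← purePrefix_mul_pureRest l.isLeft w, ← mul_assoc]
    exact wordDvd_mul_right _ _

/-- The elements of the free algebra which annihilate all normal words. -/
noncomputable def annihilator (hr : IsMonomialOrder r) (I : Ideal (Poly 𝔽 g)) :
    Ideal (Poly 𝔽 g) where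
  carrier := {p | ∀ f ∈ supported 𝔽 𝔽 (normalWords r I), polyAction hr I p f = 0}
  zero_mem' f _ := by simp
  add_mem' hp hq f hf := by simp [hp f hf, hq f hf]
  smul_mem' a p hp f hf := by simp [hp f hf]

instance (hr : IsMonomialOrder r) [I.IsTwoSided] : (annihilator hr I).IsTwoSided where
  mul_mem_of_left b ha f hf := by
    rw [map_mul, Module.End.mul_apply]
    exact ha _ (polyAction_mem hr b hf)

theorem purePart_le_annihilator (hr : IsMonomialOrder r) [I.IsTwoSided] (s : Bool) :
    purePart I s ≤ (annihilator hr I).restrictScalars 𝔽 :=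
  fun _ hp _ hf => polyAction_eq_zero hr hp hf

/-- Among the normal words there is no relation modulo an ideal generated by polynomials in the
letters of one side. -/
theorem eq_zero_of_mem_supported_normalWords (hr : IsMonomialOrder r)
    (hI : I ≤ annihilator hr I) {f : Poly 𝔽 g} (hf : f ∈ I)
    (hs : f ∈ supported 𝔽 𝔽 (normalWords r I)) : f = 0 := by
  by_contra hf0
  have hne : f.coeff.support.Nonempty := by
    rwa [Finsupp.support_nonempty_iff, Ne, coeff_eq_zero]
  obtain ⟨w, hw⟩ := hne
  -- For `I = ⊤` not even `1` is normal; a word of the nonzero `f` excludes this.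
  have h1 : (1 : Poly 𝔽 g) ∈ supported 𝔽 𝔽 (normalWords r I) :=
    single_mem_supported (mem_normalWords_of_dvd (one_wordDvd w) (hs hw))
  exact hf0 ((polyAction_apply_one hr hs).symm.trans (hI hf 1 h1))

theorem compl_normalWords_subset (hr : IsMonomialOrder r) [I.IsTwoSided] :
    (normalWords r I)ᶜ ⊆ leadingWords r (I.restrictScalars 𝔽) := by
  intro w hw
  simp only [normalWords, Set.mem_compl_iff, Set.mem_ofPred_eq, not_forall, not_not] at hw
  obtain ⟨s, d, hd, hdw⟩ := hw
  exact mem_leadingWords_of_dvd hr (leadingWords_mono inf_le_left hd) hdw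

/-- Rewriting the lower terms of `f` modulo `I` in normal words below `t` keeps the nonzero
coefficient of `t`, contradicting independence. -/
theorem notMem_leadingWords (hr : IsMonomialOrder r) [I.IsTwoSided]
    (hI : I ≤ annihilator hr I) {t : Word g} (ht : t ∈ normalWords r I) :
    t ∉ leadingWords r (I.restrictScalars 𝔽) := by
  rintro ⟨f, hf, hft⟩
  have hlow : f - single t (f.coeff t) ∈ supported 𝔽 𝔽 {w | r w t} := by
    rw [← (eq_sub_of_add_eq' (single_add_erase t f) : f.erase t = _)]
    classical
    intro w hw
    have hw' : w ∈ (f.coeff.erase t).support := hw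
    rw [Finsupp.support_erase, Finset.mem_erase] at hw'
    exact hft.2 w hw'.2 hw'.1
  have hle : supported 𝔽 𝔽 {w | r w t} ≤
      supported 𝔽 𝔽 (normalWords r I ∩ {w | r w t}) ⊔ I.restrictScalars 𝔽 := by
    refine supported_le fun w hw => ?_
    have h := single_mem_supported_sup hr (compl_normalWords_subset (I := I) hr) w
    rw [compl_compl] at h
    refine sup_le_sup_right (supported_mono ?_) (I.restrictScalars 𝔽) h
    rintro u ⟨hu, rfl | hu'⟩
    · exact ⟨hu, hw⟩
    · exact ⟨hu, hr.trans hu' hw⟩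
  obtain ⟨n, hn, k, hk, h⟩ := Submodule.mem_sup.1 (hle hlow)
  have hnt : n.coeff t = 0 := by
    by_contra h0
    exact hr.irrefl t (hn (Finset.mem_coe.2 (Finsupp.mem_support_iff.2 h0))).2
  have hsum : single t (f.coeff t) + n = f - k := by
    rw [eq_sub_iff_add_eq, add_assoc, h, add_sub_cancel]
  have hzero : single t (f.coeff t) + n = 0 := by
    refine eq_zero_of_mem_supported_normalWords hr hI ?_ ?_
    · rw [hsum]
      exact I.sub_mem hf hk
    · refine Submodule.add_mem _ ?_ (supported_mono Set.inter_subset_left hn)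
      rw [← mul_one (f.coeff t), ← smul_eq_mul, ← smul_single]
      exact Submodule.smul_mem _ _ (single_mem_supported ht)
  have hc : (single t (f.coeff t) + n).coeff t = 0 := by rw [hzero]; rfl
  rw [coeff_add, Finsupp.add_apply, hnt, add_zero, coeff_single, Finsupp.single_eq_same] at hc
  exact Finsupp.mem_support_iff.1 hft.1 hc

/-- The reduced basis of an ideal generated by polynomials in the letters of one side consists of
such polynomials. -/
theorem exists_mem_supported_of_mem_reducedBasis (hr : IsMonomialOrder r) [I.IsTwoSided]
    (hI : I ≤ annihilator hr I) {b : Poly 𝔽 g} (hb : b ∈ reducedBasis r I) :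
    ∃ s, b ∈ supported 𝔽 𝔽 (pureWords g s) := by
  obtain ⟨t, ht, hbt⟩ := hb
  have htn : ¬ t ∈ normalWords r I := fun h => notMem_leadingWords hr hI h ht.1
  simp only [normalWords, Set.mem_ofPred_eq, not_forall, not_not] at htn
  obtain ⟨s, d, hd, hdt⟩ := htn
  obtain rfl := ht.2 d (leadingWords_mono inf_le_left hd) hdt
  have hdp := leadingWords_purePart_subset hd
  have hsub := sub_normalForm_mem hr (W := purePart I s) (single d 1)
  refine ⟨s, ?_⟩
  rw [hbt.unique hr (isReducedElement_single_sub hsub.1 (fun w hw => ?_)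
    (coeff_normalForm_eq_zero hr hd _))]
  · exact hsub.2
  · obtain ⟨h1, h2⟩ := single_sub_normalForm_support hr hd hw
    refine ⟨h1, fun hwl => notMem_leadingWords hr hI ?_ hwl⟩
    have hws : w ∈ pureWords g s :=
      normalForm_purePart_mem hr (single_mem_supported hdp) hw
    intro s' e he hew
    by_cases hs : s' = s
    · subst hs
      exact h2 (mem_leadingWords_purePart_of_dvd hr he hew hws)
    -- A leading monomial from the other side dividing `w` is `1`; minimality then gives `d = 1`,
    -- and `w` would be below `1`.
    · obtain rfl := eq_one_of_mem_pureWords hs (leadingWords_purePart_subset he)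
        (mem_pureWords_of_dvd hew hws)
      obtain rfl := ht.2 1 (leadingWords_mono inf_le_left he) (one_wordDvd d)
      exact hr.not_rel_one w h1

/-! ### The involution -/

theorem adjWord_adjWord (w : Word g) : adjWord (adjWord w) = w := by
  simp [adjWord]

theorem adjWord_mul (a b : Word g) : adjWord (a * b) = adjWord b * adjWord a := by
  simp [adjWord, FreeMonoid.toList_mul]

theorem adjWord_eq_iff {a b : Word g} : adjWord a = b ↔ a = adjWord b :=
  ⟨fun h => by rw [← h, adjWord_adjWord], fun h => by rw [h, adjWord_adjWord]⟩

theorem coeff_adj (p : Poly 𝔽 g) (w : Word g) : (adj p).coeff w = star (p.coeff (adjWord w)) := by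
  classical
  simp only [adj, coeff_sum, Finsupp.finsetSum_apply, coeff_single, Finsupp.single_apply,
    adjWord_eq_iff]
  rw [Finset.sum_ite_eq']
  split_ifs with h
  · rfl
  · rw [Finsupp.notMem_support_iff.1 h, star_zero]

theorem adj_adj (p : Poly 𝔽 g) : adj (adj p) = p := by
  ext w
  rw [coeff_adj, coeff_adj, adjWord_adjWord, star_star]

theorem adj_zero : adj (0 : Poly 𝔽 g) = 0 := by
  ext w
  simp [coeff_adj]

theorem adj_add (p q : Poly 𝔽 g) : adj (p + q) = adj p + adj q := by
  ext w
  simp [coeff_adj]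

theorem adj_single (w : Word g) (c : 𝔽) :
    adj (single w c : Poly 𝔽 g) = single (adjWord w) (star c) := by
  classical
  ext v
  simp only [coeff_adj, coeff_single, Finsupp.single_apply, adjWord_eq_iff]
  split_ifs <;> simp

theorem adj_mul (p q : Poly 𝔽 g) : adj (p * q) = adj q * adj p := by
  induction p using MonoidAlgebra.induction_linear with
  | zero => simp [adj_zero]
  | add p p' hp hp' => rw [add_mul, adj_add, hp, hp', adj_add, mul_add]
  | single a c =>
    induction q using MonoidAlgebra.induction_linear with
    | zero => simp [adj_zero]
    | add q q' hq hq' => rw [mul_add, adj_add, hq, hq', adj_add, add_mul]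
    | single b d => simp only [single_mul_single, adj_single, adjWord_mul, star_mul]

theorem IsStarIdeal.adj_mem {I : Ideal (Poly 𝔽 g)} (hI : IsStarIdeal I) {p : Poly 𝔽 g}
    (hp : p ∈ I) : adj p ∈ I := by
  rw [← SetLike.mem_coe, ← hI]
  exact ⟨p, hp, rfl⟩

theorem isStarIdeal_of_adj_mem {I : Ideal (Poly 𝔽 g)} (h : ∀ p ∈ I, adj p ∈ I) :
    IsStarIdeal I := by
  ext p
  exact ⟨by rintro ⟨q, hq, rfl⟩; exact h q hq, fun hp => ⟨adj p, h p hp, adj_adj p⟩⟩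

theorem isStarIdeal_starIdealSpan (P : Set (Poly 𝔽 g)) : IsStarIdeal (starIdealSpan P) := by
  refine isStarIdeal_of_adj_mem fun p hp => ?_
  rw [starIdealSpan, Submodule.mem_sInf] at hp ⊢
  exact fun J hJ => hJ.1.adj_mem (hp J hJ)

theorem subset_starIdealSpan (P : Set (Poly 𝔽 g)) : P ⊆ starIdealSpan P := by
  intro p hp
  rw [starIdealSpan, SetLike.mem_coe, Submodule.mem_sInf]
  exact fun J hJ => hJ.2 hp

instance (P : Set (Poly 𝔽 g)) : (starIdealSpan P).IsTwoSided where
  mul_mem_of_left {a} b ha := by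
    -- Right multiplication is left multiplication conjugated by the involution.
    have h := isStarIdeal_starIdealSpan P
    have h' := h.adj_mem (Ideal.mul_mem_left _ (adj b) (h.adj_mem ha))
    rwa [adj_mul, adj_adj, adj_adj] at h'

/-- The largest `*`-ideal contained in a two-sided ideal. -/
noncomputable def starCore (K : Ideal (Poly 𝔽 g)) [K.IsTwoSided] : Ideal (Poly 𝔽 g) where
  carrier := {p | p ∈ K ∧ adj p ∈ K}
  zero_mem' := by simp [adj_zero]
  add_mem' hp hq := ⟨K.add_mem hp.1 hq.1, by rw [adj_add]; exact K.add_mem hp.2 hq.2⟩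
  smul_mem' a p hp := ⟨K.mul_mem_left a hp.1, by
    rw [smul_eq_mul, adj_mul]; exact K.mul_mem_right _ hp.2⟩

/-- `K` need not be closed under the involution, so minimality is applied to `starCore K`. This
suits the annihilator, whose construction is not symmetric under `adj`. -/
theorem starIdealSpan_le {P : Set (Poly 𝔽 g)} {K : Ideal (Poly 𝔽 g)} [K.IsTwoSided]
    (h : ∀ p ∈ P, p ∈ K ∧ adj p ∈ K) : starIdealSpan P ≤ K := by
  intro p hp
  rw [starIdealSpan, Submodule.mem_sInf] at hp
  exact (hp (starCore K) ⟨isStarIdeal_of_adj_mem fun q hq => ⟨hq.2, by rw [adj_adj]; exact hq.1⟩,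
    h⟩).1

theorem isAnalytic_iff {p : Poly 𝔽 g} :
    IsAnalytic p ↔ p ∈ supported 𝔽 𝔽 (pureWords g true) := by
  simp only [IsAnalytic, mem_supported, Set.subset_def, pureWords, Finset.mem_coe,
    Set.mem_ofPred_eq, Sum.isLeft_iff]

theorem adj_mem_supported_pureWords {s : Bool} {p : Poly 𝔽 g}
    (hp : p ∈ supported 𝔽 𝔽 (pureWords g s)) : adj p ∈ supported 𝔽 𝔽 (pureWords g !s) := by
  intro w hw l hl
  have hw' : p.coeff (adjWord w) ≠ 0 := by
    intro h
    have hw0 : (adj p).coeff w ≠ 0 := Finsupp.mem_support_iff.1 hw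
    rw [coeff_adj, h, star_zero] at hw0
    exact hw0 rfl
  have h := hp (Finset.mem_coe.2 (Finsupp.mem_support_iff.2 hw')) l.swap
    (List.mem_map.2 ⟨l, List.mem_reverse.2 hl, rfl⟩)
  rw [← h]
  cases l <;> rfl

theorem starIdealSpan_le_annihilator (hr : IsMonomialOrder r) {P : Set (Poly 𝔽 g)}
    (hP : ∀ p ∈ P, IsAnalytic p) :
    starIdealSpan P ≤ annihilator hr (starIdealSpan P) := by
  refine starIdealSpan_le fun p hp => ?_
  have hmem := subset_starIdealSpan P hp
  have han := isAnalytic_iff.1 (hP p hp)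
  exact ⟨purePart_le_annihilator hr true ⟨hmem, han⟩, purePart_le_annihilator hr false
    ⟨(isStarIdeal_starIdealSpan P).adj_mem hmem, adj_mem_supported_pureWords han⟩⟩

end

end FreeStar

theorem proposition4p1 {𝔽 : Type*} [RCLike 𝔽] (g : ℕ)
    (r : FreeStar.Word g → FreeStar.Word g → Prop) (hr : FreeStar.IsMonomialOrder r)
    (P : Set (FreeStar.Poly 𝔽 g)) (hP : ∀ p ∈ P, FreeStar.IsAnalytic p ∧ p ≠ 0) :
    ∃ G H : Set (FreeStar.Poly 𝔽 g),
      (∀ p ∈ G, FreeStar.IsAnalytic p) ∧ (∀ p ∈ H, FreeStar.IsAnalytic p) ∧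
      FreeStar.IsReducedGroebnerBasis r (FreeStar.starIdealSpan P) (G ∪ FreeStar.adj '' H) ∧
      ∀ B : Set (FreeStar.Poly 𝔽 g),
        FreeStar.IsReducedGroebnerBasis r (FreeStar.starIdealSpan P) B →
          B = G ∪ FreeStar.adj '' H := by
  have hred := FreeStar.isReducedGroebnerBasis_reducedBasis hr (FreeStar.starIdealSpan P)
  set B := FreeStar.reducedBasis r (FreeStar.starIdealSpan P) with hB
  -- The two sets may overlap in a constant, which is analytic along with its adjoint.
  have hunion : {p ∈ B | FreeStar.IsAnalytic p} ∪
      FreeStar.adj '' {h | FreeStar.IsAnalytic h ∧ FreeStar.adj h ∈ B} = B := by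
    ext b
    constructor
    · rintro (hb | ⟨h, hh, rfl⟩)
      · exact hb.1
      · exact hh.2
    · intro hb
      obtain ⟨s, hs⟩ := FreeStar.exists_mem_supported_of_mem_reducedBasis hr
        (FreeStar.starIdealSpan_le_annihilator hr fun p hp => (hP p hp).1) hb
      cases s with
      | true => exact Or.inl ⟨hb, FreeStar.isAnalytic_iff.2 hs⟩
      | false =>
        refine Or.inr ⟨FreeStar.adj b, ⟨FreeStar.isAnalytic_iff.2
          (FreeStar.adj_mem_supported_pureWords hs), ?_⟩, FreeStar.adj_adj b⟩
        rwa [FreeStar.adj_adj]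
  refine ⟨{p ∈ B | FreeStar.IsAnalytic p}, {h | FreeStar.IsAnalytic h ∧ FreeStar.adj h ∈ B},
    fun p hp => hp.2, fun p hp => hp.1, ?_, ?_⟩
  · rwa [hunion]
  · intro B' hB'
    rw [hunion]
    exact hB'.eq_reducedBasis hr
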